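/- Let $A$ denote the Glaisher–Kinkelin constant, $$A=\lim_{n\to\infty}\frac{H(n)}{n^{n^2/2+n/2+1/12}}\,e^{n^2/4},\qquad H(n)=\prod_{k=1}^n k^k,$$ and for real $z>0$ let $\mathrm{Ci}(z)=-\int_z^\infty\frac{\cos t}{t}\,dt$ denote the cosine integral (a convergent improper integral). The limit defining $A$ exists and is positive, the series $\sum_{k\ge1}\mathrm{Ci}(2k\pi)/k^2$ converges absolutely, and $$\ln A=\frac14\left[1+\frac{2}{\pi^2}\sum_{k=1}^{\infty}\frac{\mathrm{Ci}(2k\pi)}{k^2}\right].$$ Equivalently, the derivative of the Riemann zeta function at $-1$ is $$\zeta'(-1)=-\frac16-\frac{1}{2\pi^2}\sum_{k=1}^{\infty}\frac{\mathrm{Ci}(2k\pi)}{k^2}.$$ -/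

import Mathlib

open Filter Topology

namespace GlaisherKinkelin

/-- The hyperfactorial `H(n) = ∏_{k=1}^n k^k`. -/
def hyperfactorial (n : ℕ) : ℕ := ∏ k ∈ Finset.Icc 1 n, k ^ k

/-- The sequence `H(n) / n^(n²/2 + n/2 + 1/12) * e^(n²/4)`. -/
noncomputable def glaisherSeq (n : ℕ) : ℝ :=
  (hyperfactorial n : ℝ) / (n : ℝ) ^ ((n : ℝ) ^ 2 / 2 + (n : ℝ) / 2 + 1 / 12)
    * Real.exp ((n : ℝ) ^ 2 / 4)

/-- The Glaisher–Kinkelin constant `A`, the limit of `glaisherSeq`. -/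
noncomputable def glaisherA : ℝ := limUnder atTop glaisherSeq

/-- The cosine integral `Ci(z) = -∫_z^∞ cos t / t dt` for real `z > 0`. The integral converges only
conditionally, so it is the improper integral, the limit of the integrals over `[z, R]`. -/
noncomputable def Ci (z : ℝ) : ℝ :=
  limUnder atTop (fun R : ℝ => -∫ t in z..R, Real.cos t / t)

end GlaisherKinkelin

namespace GlaisherKinkelin

/-! Divide the Fourier series `∑ cos (2πkx) / k² = π² B₂({x})` by `x` and integrate over `[m, m +
1]`. The right side is elementary and equals `-2π²` times the increment of `log glaisherSeq` from
`m` to `m + 1`; the left side, rescaled, consists of integrals of `cos t / t`. Summing over `m`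
telescopes (`hasSum_log_glaisherSeq`), and dominated convergence turns the integrals into `-Ci
(2πk)`, which gives both the existence of `A` and its formula.

For zeta, Euler–Maclaurin writes `(s - 1) ζ(s)` for `Re s > 1` as an explicit term plus a series of
remainders. That series converges locally uniformly near `-1`, so the identity persists there
(`riemannZeta₁_eqOn`). At `-1` the derivatives of the remainders are twice the increments of `log
glaisherSeq`, so they telescope too, and `ζ'(-1) = 1/12 - log A`. -/

/-! ### Convergence and decay of the cosine integral. -/

theorem intervalIntegrable_inv_sq {z R : ℝ} (hz : 0 < z) (hR : z ≤ R) :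
    IntervalIntegrable (fun t : ℝ => 1 / t ^ 2) MeasureTheory.volume z R := by
  apply ContinuousOn.intervalIntegrable
  rw [Set.uIcc_of_le hR]
  exact continuousOn_const.div (by fun_prop) fun t ht => by
    have := hz.trans_le ht.1
    positivity

theorem integral_inv_sq {z R : ℝ} (hz : 0 < z) (hR : z ≤ R) :
    ∫ t in z..R, 1 / t ^ 2 = 1 / z - 1 / R := by
  have h : ∀ t ∈ Set.uIcc z R, HasDerivAt (fun t : ℝ => -t⁻¹) (1 / t ^ 2) t := fun t ht => by
    rw [Set.uIcc_of_le hR] at ht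
    have := hz.trans_le ht.1
    convert! (hasDerivAt_inv this.ne').neg using 1
    simp
  rw [intervalIntegral.integral_eq_sub_of_hasDerivAt h (intervalIntegrable_inv_sq hz hR)]
  ring

theorem intervalIntegrable_cos_div {z R : ℝ} (hz : 0 < z) (hR : z ≤ R) :
    IntervalIntegrable (fun t : ℝ => Real.cos t / t) MeasureTheory.volume z R := by
  apply ContinuousOn.intervalIntegrable
  rw [Set.uIcc_of_le hR]
  exact Real.continuous_cos.continuousOn.div continuousOn_id fun t ht => (hz.trans_le ht.1).ne'

theorem integrableOn_sin_div_sq {z : ℝ} (hz : 0 < z) :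
    MeasureTheory.IntegrableOn (fun t : ℝ => Real.sin t / t ^ 2) (Set.Ioi z) := by
  have h := integrableOn_Ioi_rpow_of_lt (by norm_num : (-2 : ℝ) < -1) hz
  refine MeasureTheory.Integrable.mono' h ?_ ?_
  · exact (Real.measurable_sin.div (measurable_id.pow_const 2)).aestronglyMeasurable
  · refine (MeasureTheory.ae_restrict_iff' measurableSet_Ioi).2 (Eventually.of_forall fun t ht => ?_)
    have ht0 : 0 < t := hz.trans ht
    rw [Real.rpow_neg ht0.le, Real.rpow_two, norm_div, Real.norm_eq_abs, Real.norm_eq_abs,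
      abs_of_pos (by positivity : 0 < t ^ 2), ← one_div]
    gcongr
    exact Real.abs_sin_le_one t

/-- Integration by parts trades the conditionally convergent integral for an absolutely convergent
one. -/
theorem integral_cos_div_eq {z R : ℝ} (hz : 0 < z) (hR : z ≤ R) :
    ∫ t in z..R, Real.cos t / t =
      Real.sin R / R - Real.sin z / z + ∫ t in z..R, Real.sin t / t ^ 2 := by
  have hpos : ∀ t ∈ Set.uIcc z R, 0 < t := fun t ht => by
    rw [Set.uIcc_of_le hR] at ht
    exact hz.trans_le ht.1
  have hsin : IntervalIntegrable (fun t : ℝ => Real.sin t / t ^ 2) MeasureTheory.volume z R :=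
    (Real.continuous_sin.continuousOn.div (by fun_prop) fun t ht =>
      (pow_pos (hpos t ht) 2).ne').intervalIntegrable
  have hcos := intervalIntegrable_cos_div hz hR
  have h : ∀ t ∈ Set.uIcc z R, HasDerivAt (fun t : ℝ => Real.sin t / t)
      (Real.cos t / t - Real.sin t / t ^ 2) t := fun t ht => by
    have := hpos t ht
    convert! (Real.hasDerivAt_sin t).div (hasDerivAt_id t) this.ne' using 1
    simp only [id]
    field_simp
  rw [← intervalIntegral.integral_eq_sub_of_hasDerivAt h (hcos.sub hsin),
    intervalIntegral.integral_sub hcos hsin]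
  ring

/-- Uniformity in `R` is what later provides the dominating series. -/
theorem abs_integral_cos_div_le {z R : ℝ} (hz : 0 < z) (hR : z ≤ R) :
    |∫ t in z..R, Real.cos t / t| ≤ 2 / z := by
  have hR0 := hz.trans_le hR
  have h1 : |∫ t in z..R, Real.sin t / t ^ 2| ≤ 1 / z - 1 / R := by
    rw [← integral_inv_sq hz hR, ← Real.norm_eq_abs]
    refine intervalIntegral.norm_integral_le_of_norm_le hR
      (Eventually.of_forall fun t ht => ?_) (intervalIntegrable_inv_sq hz hR)
    have := hz.trans ht.1
    rw [Real.norm_eq_abs, abs_div, abs_of_pos (by positivity : 0 < t ^ 2)]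
    gcongr
    exact Real.abs_sin_le_one t
  have h2 : ∀ x : ℝ, 0 < x → |Real.sin x / x| ≤ 1 / x := fun x hx => by
    rw [abs_div, abs_of_pos hx]
    gcongr
    exact Real.abs_sin_le_one x
  have h3 := h2 z hz
  have h4 := h2 R hR0
  rw [integral_cos_div_eq hz hR]
  rw [abs_le] at *
  have : 2 / z = 1 / z + 1 / z := by ring
  constructor <;> linarith [h1.1, h1.2, h3.1, h3.2, h4.1, h4.2]

theorem tendsto_Ci {z : ℝ} (hz : 0 < z) :
    Tendsto (fun R : ℝ => -∫ t in z..R, Real.cos t / t) atTop (𝓝 (Ci z)) := by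
  have h1 : Tendsto (fun R : ℝ => Real.sin R / R) atTop (𝓝 0) := by
    refine squeeze_zero_norm' ?_ tendsto_inv_atTop_zero
    filter_upwards [eventually_gt_atTop 0] with R hR
    rw [norm_div, Real.norm_eq_abs, Real.norm_of_nonneg hR.le, ← one_div]
    gcongr
    exact Real.abs_sin_le_one R
  have h2 := MeasureTheory.intervalIntegral_tendsto_integral_Ioi z (integrableOn_sin_div_sq hz)
    tendsto_id
  have h3 := ((h1.sub_const (Real.sin z / z)).add h2).neg
  refine tendsto_nhds_limUnder ⟨_, h3.congr' ?_⟩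
  filter_upwards [eventually_ge_atTop z] with R hR
  rw [integral_cos_div_eq hz hR]
  rfl

theorem abs_Ci_le {z : ℝ} (hz : 0 < z) : |Ci z| ≤ 2 / z := by
  refine le_of_tendsto (tendsto_Ci hz).abs ?_
  filter_upwards [eventually_ge_atTop z] with R hR
  rw [abs_neg]
  exact abs_integral_cos_div_le hz hR

theorem summable_one_div_add_one_sq : Summable (fun k : ℕ => 1 / ((k : ℝ) + 1) ^ 2) := by
  have := (summable_nat_add_iff 1).2 (Real.summable_one_div_nat_pow.2 (by norm_num : 1 < 2))
  simpa using this

theorem one_le_two_mul_pi (k : ℕ) : 2 ≤ 2 * ((k : ℝ) + 1) * Real.pi := by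
  have := Real.pi_gt_three
  have hk : (0 : ℝ) ≤ k := k.cast_nonneg
  nlinarith

theorem summable_Ci :
    Summable (fun k : ℕ => Ci (2 * ((k : ℝ) + 1) * Real.pi) / ((k : ℝ) + 1) ^ 2) := by
  refine Summable.of_norm_bounded summable_one_div_add_one_sq fun k => ?_
  have h := one_le_two_mul_pi k
  rw [norm_div, Real.norm_eq_abs, Real.norm_of_nonneg (by positivity)]
  gcongr
  exact (abs_Ci_le (by linarith)).trans ((div_le_one (by linarith)).2 h)

/-! ### The Fourier series of `B₂` integrated against `1 / x`. -/

/-- The Fourier expansion of the second Bernoulli polynomial, periodically continued. -/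
theorem hasSum_cos_div_sq {m : ℕ} {x : ℝ} (hx : x ∈ Set.Icc (m : ℝ) (m + 1)) :
    HasSum (fun k : ℕ => 1 / ((k : ℝ) + 1) ^ 2 * Real.cos (2 * ((k : ℝ) + 1) * Real.pi * x))
      (Real.pi ^ 2 * ((x - m) ^ 2 - (x - m) + 6⁻¹)) := by
  have h := hasSum_one_div_nat_pow_mul_cos (k := 1) one_ne_zero (x := x - m)
    ⟨by linarith [hx.1], by linarith [hx.2]⟩
  have hb := bernoulliFun_two (x - m)
  rw [bernoulliFun] at hb
  rw [mul_one, hb] at h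
  -- The term of index 0 is zero because `1 / 0 = 0`, so shifting the index changes nothing in the
  -- sum.
  convert! (hasSum_nat_add_iff' 1).2 h using 1
  · ext k : 1
    have : 2 * Real.pi * ((k + 1 : ℕ) : ℝ) * (x - m) =
        2 * ((k : ℝ) + 1) * Real.pi * x - (((k + 1) * m : ℕ) : ℝ) * (2 * Real.pi) := by
      push_cast
      ring
    rw [this, Real.cos_sub_nat_mul_two_pi]
    push_cast
    rfl
  · rw [Finset.sum_range_one, Nat.factorial_two]
    push_cast
    ring

theorem integral_cos_mul_div {c a b : ℝ} (hc : 0 < c) :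
    ∫ x in a..b, Real.cos (c * x) / x = ∫ t in (c * a)..(c * b), Real.cos t / t := by
  rw [← intervalIntegral.smul_integral_comp_mul_left, smul_eq_mul,
    ← intervalIntegral.integral_const_mul]
  congr 1
  ext x
  field_simp

theorem integral_bernoulli_two_div {m : ℕ} (hm : 0 < m) :
    ∫ x in (m : ℝ)..(m + 1), ((x - m) ^ 2 - (x - m) + 6⁻¹) / x =
      ((m : ℝ) ^ 2 + m + 1 / 6) * (Real.log (m + 1) - Real.log m) - (2 * m + 1) / 2 := by
  have hm' : (0 : ℝ) < m := Nat.cast_pos.2 hm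
  have hpos : ∀ x ∈ Set.uIcc (m : ℝ) (m + 1), 0 < x := fun x hx => by
    rw [Set.uIcc_of_le (by linarith)] at hx
    exact hm'.trans_le hx.1
  have h : ∀ x ∈ Set.uIcc (m : ℝ) (m + 1), HasDerivAt
      (fun x : ℝ => x ^ 2 / 2 - (2 * m + 1) * x + ((m : ℝ) ^ 2 + m + 1 / 6) * Real.log x)
      (((x - m) ^ 2 - (x - m) + 6⁻¹) / x) x := fun x hx => by
    have := hpos x hx
    convert! (((hasDerivAt_pow 2 x).div_const 2).sub ((hasDerivAt_id x).const_mul _)).add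
      ((Real.hasDerivAt_log this.ne').const_mul _) using 1
    field_simp
    push_cast
    ring
  rw [intervalIntegral.integral_eq_sub_of_hasDerivAt h]
  · ring
  · exact (ContinuousOn.div (by fun_prop) continuousOn_id
      fun x hx => (hpos x hx).ne').intervalIntegrable

theorem hasSum_integral_cos_div {m : ℕ} (hm : 0 < m) :
    HasSum (fun k : ℕ => 1 / ((k : ℝ) + 1) ^ 2 *
        ∫ t in (2 * ((k : ℝ) + 1) * Real.pi * m)..(2 * ((k : ℝ) + 1) * Real.pi * (m + 1)),
          Real.cos t / t)
      (Real.pi ^ 2 * (((m : ℝ) ^ 2 + m + 1 / 6) * (Real.log (m + 1) - Real.log m)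
        - (2 * m + 1) / 2)) := by
  have hm' : (1 : ℝ) ≤ m := Nat.one_le_cast.2 hm
  have hle : (m : ℝ) ≤ m + 1 := by linarith
  -- Since `x ≥ m ≥ 1`, dividing by `x` keeps the terms below `1 / (k + 1) ^ 2`.
  have h := intervalIntegral.hasSum_integral_of_dominated_convergence
    (μ := MeasureTheory.volume) (a := (m : ℝ)) (b := m + 1)
    (F := fun (k : ℕ) x =>
      1 / ((k : ℝ) + 1) ^ 2 * (Real.cos (2 * ((k : ℝ) + 1) * Real.pi * x) / x))
    (f := fun x => Real.pi ^ 2 * (((x - m) ^ 2 - (x - m) + 6⁻¹) / x))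
    (fun k _ => 1 / ((k : ℝ) + 1) ^ 2)
    (fun k => by
      apply Measurable.aestronglyMeasurable
      fun_prop)
    (fun k => Eventually.of_forall fun x hx => by
      rw [Set.uIoc_of_le hle] at hx
      have hx1 : 1 ≤ x := hm'.trans hx.1.le
      rw [norm_mul, Real.norm_of_nonneg (by positivity : 0 ≤ 1 / ((k : ℝ) + 1) ^ 2)]
      refine mul_le_of_le_one_right (by positivity) ?_
      rw [norm_div, Real.norm_eq_abs, Real.norm_of_nonneg (by linarith)]
      exact (div_le_one (by linarith)).2 ((Real.abs_cos_le_one _).trans hx1))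
    (Eventually.of_forall fun _ _ => summable_one_div_add_one_sq)
    (by simp)
    (Eventually.of_forall fun x hx => by
      rw [Set.uIoc_of_le hle] at hx
      have := (hasSum_cos_div_sq (m := m) ⟨hx.1.le, hx.2⟩).div_const x
      simpa only [mul_div_assoc] using this)
  rw [intervalIntegral.integral_const_mul, integral_bernoulli_two_div hm] at h
  refine h.congr_fun fun k => ?_
  rw [intervalIntegral.integral_const_mul,
    integral_cos_mul_div (by have := one_le_two_mul_pi k; linarith)]

/-! ### The hyperfactorial and the limit of `glaisherSeq`. -/

theorem hyperfactorial_succ (n : ℕ) :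
    hyperfactorial (n + 1) = hyperfactorial n * (n + 1) ^ (n + 1) :=
  Finset.prod_Icc_succ_top (by omega) _

theorem hyperfactorial_pos (n : ℕ) : 0 < hyperfactorial n :=
  Finset.prod_pos fun k hk => pow_pos (by have := (Finset.mem_Icc.1 hk).1; omega) k

theorem log_hyperfactorial_succ (n : ℕ) :
    Real.log (hyperfactorial (n + 1)) =
      Real.log (hyperfactorial n) + (n + 1) * Real.log (n + 1) := by
  have := hyperfactorial_pos n
  rw [hyperfactorial_succ]
  push_cast
  rw [Real.log_mul (by positivity) (by positivity), Real.log_pow]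
  push_cast
  rfl

theorem glaisherSeq_pos {n : ℕ} (hn : 0 < n) : 0 < glaisherSeq n := by
  have := hyperfactorial_pos n
  unfold glaisherSeq
  positivity

theorem log_glaisherSeq {n : ℕ} (hn : 0 < n) :
    Real.log (glaisherSeq n) = Real.log (hyperfactorial n)
      - ((n : ℝ) ^ 2 / 2 + (n : ℝ) / 2 + 1 / 12) * Real.log n + (n : ℝ) ^ 2 / 4 := by
  have := hyperfactorial_pos n
  unfold glaisherSeq
  rw [Real.log_mul (by positivity) (by positivity), Real.log_div (by positivity) (by positivity),
    Real.log_exp, Real.log_rpow (by positivity)]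

/-- The constant `1 / 2` is `2 * log (glaisherSeq 1)`, so both sides vanish at `n = 0`. -/
theorem hasSum_log_glaisherSeq (n : ℕ) :
    HasSum (fun k : ℕ => 1 / ((k : ℝ) + 1) ^ 2 *
        ∫ t in (2 * ((k : ℝ) + 1) * Real.pi)..(2 * ((k : ℝ) + 1) * Real.pi * (n + 1)),
          Real.cos t / t)
      (Real.pi ^ 2 * (1 / 2 - 2 * Real.log (glaisherSeq (n + 1)))) := by
  induction n with
  | zero =>
    rw [log_glaisherSeq (by omega)]
    convert hasSum_zero using 1
    · simp
    · simp [hyperfactorial]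
      norm_num
  | succ n ih =>
    have h := ih.add (hasSum_integral_cos_div (Nat.succ_pos n))
    convert h using 1
    · ext k
      have h1 := one_le_two_mul_pi k
      have hn : (0 : ℝ) ≤ n := n.cast_nonneg
      have h2 : 2 * ((k : ℝ) + 1) * Real.pi ≤ 2 * ((k : ℝ) + 1) * Real.pi * (n + 1) := by nlinarith
      have h3 : 2 * ((k : ℝ) + 1) * Real.pi * (n + 1) ≤ 2 * ((k : ℝ) + 1) * Real.pi * (n + 1 + 1) := by
        nlinarith
      rw [← mul_add]
      push_cast
      rw [intervalIntegral.integral_add_adjacent_intervals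
        (intervalIntegrable_cos_div (by linarith) h2) (intervalIntegrable_cos_div (by linarith) h3)]
    · rw [log_glaisherSeq (by omega), log_glaisherSeq (by omega), log_hyperfactorial_succ (n + 1)]
      push_cast
      ring

theorem tendsto_log_glaisherSeq :
    Tendsto (fun n => Real.log (glaisherSeq n)) atTop
      (𝓝 (1 / 4 * (1 + 2 / Real.pi ^ 2 *
        ∑' k : ℕ, Ci (2 * ((k : ℝ) + 1) * Real.pi) / ((k : ℝ) + 1) ^ 2))) := by
  rw [← tendsto_add_atTop_iff_nat 1]
  have h : Tendsto (fun n : ℕ => ∑' k : ℕ, 1 / ((k : ℝ) + 1) ^ 2 *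
      ∫ t in (2 * ((k : ℝ) + 1) * Real.pi)..(2 * ((k : ℝ) + 1) * Real.pi * (n + 1)),
        Real.cos t / t) atTop
      (𝓝 (∑' k : ℕ, 1 / ((k : ℝ) + 1) ^ 2 * -Ci (2 * ((k : ℝ) + 1) * Real.pi))) := by
    refine tendsto_tsum_of_dominated_convergence summable_one_div_add_one_sq (fun k => ?_)
      (Eventually.of_forall fun n k => ?_)
    · have h1 := one_le_two_mul_pi k
      have h2 : Tendsto (fun n : ℕ => 2 * ((k : ℝ) + 1) * Real.pi * ((n : ℝ) + 1)) atTop atTop :=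
        (tendsto_atTop_add_const_right _ 1 tendsto_natCast_atTop_atTop).const_mul_atTop
          (by linarith)
      have h0 : 0 < 2 * ((k : ℝ) + 1) * Real.pi := by linarith
      simpa [-one_div] using (((tendsto_Ci h0).comp h2).neg).const_mul (1 / ((k : ℝ) + 1) ^ 2)
    · have h1 := one_le_two_mul_pi k
      have hn : (0 : ℝ) ≤ n := n.cast_nonneg
      rw [norm_mul, Real.norm_of_nonneg (by positivity : 0 ≤ 1 / ((k : ℝ) + 1) ^ 2)]
      refine mul_le_of_le_one_right (by positivity) ?_
      exact (abs_integral_cos_div_le (by linarith) (by nlinarith)).trans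
        ((div_le_one (by linarith)).2 h1)
  simp only [(hasSum_log_glaisherSeq _).tsum_eq] at h
  have hs : ∑' k : ℕ, 1 / ((k : ℝ) + 1) ^ 2 * -Ci (2 * ((k : ℝ) + 1) * Real.pi) =
      -∑' k : ℕ, Ci (2 * ((k : ℝ) + 1) * Real.pi) / ((k : ℝ) + 1) ^ 2 := by
    rw [← tsum_neg]
    congr 1
    ext k
    ring
  rw [hs] at h
  have hpi := Real.pi_pos
  -- The map `y ↦ -y / (2π²) + 1 / 4` recovers `L` from `y = π² (1 / 2 - 2L)`.
  convert! (h.const_mul (-(1 / (2 * Real.pi ^ 2)))).add_const (1 / 4) using 1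
  · ext n
    field_simp
    ring
  · congr 1
    field_simp
    ring

theorem tendsto_glaisherSeq_exp :
    Tendsto glaisherSeq atTop
      (𝓝 (Real.exp (1 / 4 * (1 + 2 / Real.pi ^ 2 *
        ∑' k : ℕ, Ci (2 * ((k : ℝ) + 1) * Real.pi) / ((k : ℝ) + 1) ^ 2)))) := by
  refine ((Real.continuous_exp.tendsto _).comp tendsto_log_glaisherSeq).congr' ?_
  filter_upwards [eventually_gt_atTop 0] with n hn
  exact Real.exp_log (glaisherSeq_pos hn)

theorem glaisherA_eq : glaisherA = Real.exp (1 / 4 * (1 + 2 / Real.pi ^ 2 *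
    ∑' k : ℕ, Ci (2 * ((k : ℝ) + 1) * Real.pi) / ((k : ℝ) + 1) ^ 2)) :=
  tendsto_glaisherSeq_exp.limUnder_eq

/-! ### The Euler–Maclaurin remainder. -/

theorem hasDerivAt_ofReal_cpow_of_pos {x : ℝ} (hx : 0 < x) (r : ℂ) :
    HasDerivAt (fun y : ℝ => (y : ℂ) ^ r) (r * (x : ℂ) ^ (r - 1)) x := by
  rcases eq_or_ne r 0 with rfl | hr
  · simpa using hasDerivAt_const x (1 : ℂ)
  · exact hasDerivAt_ofReal_cpow_const hx.ne' hr

/-- `s - 1` times the first three terms of the Euler–Maclaurin expansion of `∑_{k ≥ n} k ^ (-s)`. -/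
noncomputable def eulerMaclaurinTail (n : ℕ) (s : ℂ) : ℂ :=
  (n : ℂ) ^ (1 - s) + (s - 1) * (n : ℂ) ^ (-s) / 2 + s * (s - 1) * (n : ℂ) ^ (-s - 1) / 12

/-- The `n + 1`-st term of the Euler–Maclaurin remainder series of `(s - 1) * riemannZeta s`. -/
noncomputable def zetaRemainder (n : ℕ) (s : ℂ) : ℂ :=
  (s - 1) * ((n + 1 : ℕ) : ℂ) ^ (-s) - eulerMaclaurinTail (n + 1) s + eulerMaclaurinTail (n + 2) s

/-- Minus the primitive of `(t ^ 3 - 3 / 2 * t ^ 2 + t / 2) / 6` times the fourth derivative of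
`(a + t) ^ (1 - s)` gives the Euler–Maclaurin remainder on `[a, a + 1]`. -/
noncomputable def remainderPrimitive (a : ℝ) (s : ℂ) (t : ℝ) : ℂ :=
  ((t ^ 3 - 3 / 2 * t ^ 2 + t / 2 : ℝ) : ℂ) / 6 *
      ((1 - s) * -s * (-s - 1) * ((a + t : ℝ) : ℂ) ^ (-s - 2))
    - ((t ^ 2 - t + 1 / 6 : ℝ) : ℂ) / 2 * ((1 - s) * -s * ((a + t : ℝ) : ℂ) ^ (-s - 1))
    + ((t - 1 / 2 : ℝ) : ℂ) * ((1 - s) * ((a + t : ℝ) : ℂ) ^ (-s))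
    - ((a + t : ℝ) : ℂ) ^ (1 - s)

/-- The polynomials are `B₃`, `B₂`, `B₁`; by `Bₖ' = k Bₖ₋₁` all terms cancel except the one with the
fourth derivative. -/
theorem hasDerivAt_remainderPrimitive {a t : ℝ} (h : 0 < a + t) (s : ℂ) :
    HasDerivAt (remainderPrimitive a s)
      (((t ^ 3 - 3 / 2 * t ^ 2 + t / 2 : ℝ) : ℂ) / 6 *
        ((1 - s) * -s * (-s - 1) * (-s - 2) * ((a + t : ℝ) : ℂ) ^ (-s - 3))) t := by
  have hp (r : ℂ) : HasDerivAt (fun t : ℝ => ((a + t : ℝ) : ℂ) ^ r)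
      (r * ((a + t : ℝ) : ℂ) ^ (r - 1)) t :=
    (hasDerivAt_ofReal_cpow_of_pos h r).comp_const_add a t
  have h3 : HasDerivAt (fun t : ℝ => t ^ 3 - 3 / 2 * t ^ 2 + t / 2) (3 * (t ^ 2 - t + 1 / 6)) t := by
    convert! ((hasDerivAt_pow 3 t).sub ((hasDerivAt_pow 2 t).const_mul (3 / 2))).add
      ((hasDerivAt_id t).div_const 2) using 1
    push_cast
    ring
  have h2 : HasDerivAt (fun t : ℝ => t ^ 2 - t + 1 / 6) (2 * (t - 1 / 2)) t := by
    convert! ((hasDerivAt_pow 2 t).sub (hasDerivAt_id t)).add_const (1 / 6 : ℝ) using 1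
    push_cast
    ring
  have h1 : HasDerivAt (fun t : ℝ => t - 1 / 2) 1 t := (hasDerivAt_id t).sub_const _
  have e1 : 1 - s - 1 = -s := by ring
  have e2 : -s - 1 - 1 = -s - 2 := by ring
  have e3 : -s - 2 - 1 = -s - 3 := by ring
  have hd0 := hp (1 - s)
  have hd1 := hp (-s)
  have hd2 := hp (-s - 1)
  have hd3 := hp (-s - 2)
  rw [e1] at hd0
  rw [e2] at hd2
  rw [e3] at hd3
  convert! ((((h3.ofReal_comp.div_const 6).mul (hd3.const_mul ((1 - s) * -s * (-s - 1)))).sub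
    ((h2.ofReal_comp.div_const 2).mul (hd2.const_mul ((1 - s) * -s)))).add
    (h1.ofReal_comp.mul (hd1.const_mul (1 - s)))).sub hd0 using 1
  push_cast
  ring

/-- Only boundary values enter: `B₃` vanishes at 0 and 1, `B₂` is `1 / 6` at both, and `B₁` is `∓1 /
2`. -/
theorem zetaRemainder_eq (n : ℕ) (s : ℂ) :
    zetaRemainder n s =
      -(remainderPrimitive (n + 1) s 1 - remainderPrimitive (n + 1) s 0) := by
  simp only [zetaRemainder, eulerMaclaurinTail, remainderPrimitive]
  have e : (n : ℂ) + 2 = n + 1 + 1 := by ring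
  push_cast
  rw [e, add_zero]
  ring

/-- The integrand has size `(n + 1) ^ (-Re s - 3)`; the cutoff `-3 / 2` keeps this summable while
leaving room around `-1`. -/
theorem norm_zetaRemainder_le (n : ℕ) {s : ℂ} (hs : -3 / 2 ≤ s.re) :
    ‖zetaRemainder n s‖ ≤
      ‖(1 - s) * -s * (-s - 1) * (-s - 2)‖ * (1 / ((n : ℝ) + 1) ^ (3 / 2 : ℝ)) := by
  have hn : (0 : ℝ) ≤ n := n.cast_nonneg
  rw [zetaRemainder_eq, norm_neg]
  refine norm_image_sub_le_of_norm_deriv_le_segment_01'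
    (fun t ht => (hasDerivAt_remainderPrimitive (by linarith [ht.1]) s).hasDerivWithinAt)
    fun t ht => ?_
  have ht0 := ht.1
  have ht1 := ht.2
  have hb : ‖((t ^ 3 - 3 / 2 * t ^ 2 + t / 2 : ℝ) : ℂ) / 6‖ ≤ 1 := by
    rw [norm_div, Complex.norm_real, Real.norm_eq_abs, Complex.norm_ofNat,
      div_le_one (by norm_num), abs_le]
    constructor <;> nlinarith [mul_nonneg ht0 ht0, mul_nonneg (mul_nonneg ht0 ht0) ht0]
  have hpow : ‖((n + 1 + t : ℝ) : ℂ) ^ (-s - 3)‖ ≤ 1 / ((n : ℝ) + 1) ^ (3 / 2 : ℝ) := by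
    rw [Complex.norm_cpow_eq_rpow_re_of_pos (by linarith), one_div, ← Real.rpow_neg (by linarith)]
    calc ((n : ℝ) + 1 + t) ^ (-s - 3).re ≤ ((n : ℝ) + 1 + t) ^ (-(3 / 2) : ℝ) := by
          refine Real.rpow_le_rpow_of_exponent_le (by linarith) ?_
          simp
          linarith
      _ ≤ ((n : ℝ) + 1) ^ (-(3 / 2) : ℝ) :=
          Real.rpow_le_rpow_of_nonpos (by linarith) (by linarith) (by norm_num)
  rw [norm_mul, norm_mul (_ * _ * _ * _)]
  exact (mul_le_of_le_one_left (by positivity) hb).trans (by gcongr)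

theorem summable_one_div_rpow_three_halves :
    Summable (fun n : ℕ => 1 / ((n : ℝ) + 1) ^ (3 / 2 : ℝ)) := by
  have := (summable_nat_add_iff 1).2
    (Real.summable_one_div_nat_rpow.2 (by norm_num : (1 : ℝ) < 3 / 2))
  simpa using this

/-! ### Derivatives in `s`, and their values at `-1`. -/

theorem hasDerivAt_natCast_cpow {n : ℕ} (hn : 0 < n) {f : ℂ → ℂ} {f' s : ℂ}
    (hf : HasDerivAt f f' s) :
    HasDerivAt (fun s => (n : ℂ) ^ f s) ((n : ℂ) ^ f s * Real.log n * f') s := by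
  rw [Complex.natCast_log]
  exact hf.const_cpow (Or.inl (Nat.cast_ne_zero.2 hn.ne'))

theorem hasDerivAt_eulerMaclaurinTail {n : ℕ} (hn : 0 < n) (s : ℂ) :
    HasDerivAt (eulerMaclaurinTail n)
      (-((n : ℂ) ^ (1 - s) * Real.log n) +
        ((n : ℂ) ^ (-s) - (s - 1) * ((n : ℂ) ^ (-s) * Real.log n)) / 2 +
        ((2 * s - 1) * (n : ℂ) ^ (-s - 1)
          - s * (s - 1) * ((n : ℂ) ^ (-s - 1) * Real.log n)) / 12) s := by
  have hid := hasDerivAt_id s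
  convert! ((hasDerivAt_natCast_cpow hn (hid.const_sub 1)).add
    (((hid.sub_const 1).mul (hasDerivAt_natCast_cpow hn hid.neg)).div_const 2)).add
    (((hid.mul (hid.sub_const 1)).mul
      (hasDerivAt_natCast_cpow hn (hid.neg.sub_const 1))).div_const 12) using 1
  simp only [id, Pi.neg_apply, Pi.mul_apply]
  ring

theorem hasDerivAt_zetaRemainder (n : ℕ) (s : ℂ) :
    HasDerivAt (zetaRemainder n)
      (((n + 1 : ℕ) : ℂ) ^ (-s) - (s - 1) * (((n + 1 : ℕ) : ℂ) ^ (-s) * Real.log (n + 1 : ℕ))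
        - deriv (eulerMaclaurinTail (n + 1)) s + deriv (eulerMaclaurinTail (n + 2)) s) s := by
  have hid := hasDerivAt_id s
  have h1 := (hasDerivAt_eulerMaclaurinTail (Nat.succ_pos n) s).differentiableAt.hasDerivAt
  have h2 := (hasDerivAt_eulerMaclaurinTail (Nat.succ_pos (n + 1)) s).differentiableAt.hasDerivAt
  convert! (((hid.sub_const 1).mul
    (hasDerivAt_natCast_cpow (Nat.succ_pos n) hid.neg)).sub h1).add h2 using 1
  simp only [id, Pi.neg_apply]
  ring

theorem deriv_eulerMaclaurinTail_neg_one {n : ℕ} (hn : 0 < n) :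
    deriv (eulerMaclaurinTail n) (-1) =
      ((-((n : ℝ) ^ 2 * Real.log n) + n / 2 + n * Real.log n - 1 / 4 - Real.log n / 6 : ℝ) : ℂ) := by
  have e : (1 : ℂ) - -1 = (2 : ℕ) := by norm_num
  rw [(hasDerivAt_eulerMaclaurinTail hn (-1)).deriv, e, Complex.cpow_natCast, neg_neg, sub_self,
    Complex.cpow_one, Complex.cpow_zero]
  push_cast
  ring

theorem deriv_zetaRemainder_neg_one (n : ℕ) :
    deriv (zetaRemainder n) (-1) =
      ((2 * Real.log (glaisherSeq (n + 1 + 1)) - 2 * Real.log (glaisherSeq (n + 1)) : ℝ) : ℂ) := by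
  rw [(hasDerivAt_zetaRemainder n (-1)).deriv, deriv_eulerMaclaurinTail_neg_one (by omega),
    deriv_eulerMaclaurinTail_neg_one (by omega), log_glaisherSeq (by omega),
    log_glaisherSeq (by omega), log_hyperfactorial_succ (n + 1), neg_neg, Complex.cpow_one]
  push_cast
  ring_nf

/-! ### Analytic continuation to `-1` and the value of `ζ'(-1)`. -/

theorem tendsto_eulerMaclaurinTail {s : ℂ} (hs : 1 < s.re) :
    Tendsto (fun n => eulerMaclaurinTail n s) atTop (𝓝 0) := by
  have h (r : ℂ) (hr : r.re < 0) : Tendsto (fun n : ℕ => (n : ℂ) ^ r) atTop (𝓝 0) := by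
    rw [tendsto_zero_iff_norm_tendsto_zero]
    refine ((tendsto_rpow_neg_atTop (neg_pos.2 hr)).comp tendsto_natCast_atTop_atTop).congr' ?_
    filter_upwards [eventually_gt_atTop 0] with n hn
    rw [Complex.norm_natCast_cpow_of_pos hn]
    simp
  have h1 := h (1 - s) (by simpa using hs)
  have h2 := h (-s) (by simp; linarith)
  have h3 := h (-s - 1) (by simp; linarith)
  simpa [eulerMaclaurinTail] using (h1.add ((h2.const_mul (s - 1)).div_const 2)).add
    ((h3.const_mul (s * (s - 1))).div_const 12)

theorem sum_zetaRemainder (N : ℕ) (s : ℂ) :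
    ∑ n ∈ Finset.range N, zetaRemainder n s =
      (s - 1) * ∑ n ∈ Finset.range N, 1 / ((n : ℂ) + 1) ^ s - eulerMaclaurinTail 1 s
        + eulerMaclaurinTail (N + 1) s := by
  induction N with
  | zero => simp
  | succ N ih =>
    rw [Finset.sum_range_succ, Finset.sum_range_succ, ih, zetaRemainder, Complex.cpow_neg]
    push_cast
    ring

theorem sub_one_mul_riemannZeta_of_one_lt_re {s : ℂ} (hs : 1 < s.re) :
    (s - 1) * riemannZeta s = eulerMaclaurinTail 1 s + ∑' n, zetaRemainder n s := by
  have hsum : Summable (fun n => zetaRemainder n s) :=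
    .of_norm_bounded (summable_one_div_rpow_three_halves.mul_left _)
      fun n => norm_zetaRemainder_le n (by linarith)
  have hz : Summable (fun n : ℕ => 1 / ((n : ℂ) + 1) ^ s) := by
    simpa using (summable_nat_add_iff 1).2 (Complex.summable_one_div_nat_cpow.2 hs)
  have h1 := hsum.hasSum.tendsto_sum_nat
  have h2 := ((hz.hasSum.tendsto_sum_nat.const_mul (s - 1)).sub_const
    (eulerMaclaurinTail 1 s)).add ((tendsto_add_atTop_iff_nat 1).2 (tendsto_eulerMaclaurinTail hs))
  simp only [← sum_zetaRemainder] at h2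
  rw [tendsto_nhds_unique h1 h2, zeta_eq_tsum_one_div_nat_add_one_cpow hs]
  ring

/-- This ball contains `-1` and points with `Re s > 1`, and lies in `Re s ≥ -3 / 2`. The last three
factors bound `|s|`, `|s + 1|`, `|s + 2|`. -/
theorem norm_zetaRemainder_le_of_mem_ball (n : ℕ) {s : ℂ} (hs : s ∈ Metric.ball (1 : ℂ) (5 / 2)) :
    ‖zetaRemainder n s‖ ≤ (5 / 2 * (7 / 2) * (9 / 2) * (11 / 2)) *
      (1 / ((n : ℝ) + 1) ^ (3 / 2 : ℝ)) := by
  rw [mem_ball_iff_norm'] at hs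
  have hre := (Complex.abs_re_le_norm (1 - s)).trans hs.le
  rw [Complex.sub_re, Complex.one_re, abs_le] at hre
  refine (norm_zetaRemainder_le n (by linarith [hre.2])).trans ?_
  have h (c : ℂ) : ‖-s - c‖ ≤ 5 / 2 + ‖1 + c‖ := by
    calc ‖-s - c‖ = ‖(1 - s) - (1 + c)‖ := by ring_nf
      _ ≤ ‖1 - s‖ + ‖1 + c‖ := norm_sub_le _ _
      _ ≤ _ := by gcongr
  have h0 := h 0
  have h1 := h 1
  have h2 := h 2
  norm_num at h0 h1 h2
  rw [norm_mul, norm_mul, norm_mul, norm_neg]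
  gcongr

theorem riemannZeta₁_eqOn :
    Set.EqOn riemannZeta₁ (fun s => eulerMaclaurinTail 1 s + ∑' n, zetaRemainder n s)
      (Metric.ball (1 : ℂ) (5 / 2)) := by
  have hd : DifferentiableOn ℂ (fun s => eulerMaclaurinTail 1 s + ∑' n, zetaRemainder n s)
      (Metric.ball (1 : ℂ) (5 / 2)) :=
    .add (fun s _ => (hasDerivAt_eulerMaclaurinTail one_pos s).differentiableAt
        |>.differentiableWithinAt)
      (Complex.differentiableOn_tsum_of_summable_norm
        (summable_one_div_rpow_three_halves.mul_left _)
        (fun n s _ => (hasDerivAt_zetaRemainder n s).differentiableAt.differentiableWithinAt)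
        Metric.isOpen_ball fun n s hs => norm_zetaRemainder_le_of_mem_ball n hs)
  refine (differentiable_riemannZeta₁.differentiableOn.analyticOnNhd
    Metric.isOpen_ball).eqOn_of_preconnected_of_eventuallyEq (hd.analyticOnNhd Metric.isOpen_ball)
    (convex_ball _ _).isPreconnected (z₀ := 2) (by norm_num [dist_eq_norm]) ?_
  filter_upwards [(isOpen_lt continuous_const Complex.continuous_re).mem_nhds
    (show (1 : ℝ) < (2 : ℂ).re by norm_num)] with s hs
  have hs1 : s ≠ 1 := by
    rintro rfl
    simp at hs
  rw [← sub_one_mul_riemannZeta_of_one_lt_re hs, riemannZeta_eq_inv_sub_mul hs1,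
    mul_inv_cancel_left₀ (sub_ne_zero.2 hs1)]

theorem deriv_riemannZeta₁_neg_one {l : ℝ}
    (hl : Tendsto (fun n => Real.log (glaisherSeq n)) atTop (𝓝 l)) :
    deriv riemannZeta₁ (-1) = ((2 * l - 1 / 4 : ℝ) : ℂ) := by
  have hmem : (-1 : ℂ) ∈ Metric.ball (1 : ℂ) (5 / 2) := by norm_num [dist_eq_norm]
  have hS := Complex.hasSum_deriv_of_summable_norm
    (summable_one_div_rpow_three_halves.mul_left _)
    (fun n s _ => (hasDerivAt_zetaRemainder n s).differentiableAt.differentiableWithinAt)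
    Metric.isOpen_ball (fun n s hs => norm_zetaRemainder_le_of_mem_ball n hs) hmem
  have hdiff := (Complex.differentiableOn_tsum_of_summable_norm
    (summable_one_div_rpow_three_halves.mul_left _)
    (fun n s _ => (hasDerivAt_zetaRemainder n s).differentiableAt.differentiableWithinAt)
    Metric.isOpen_ball (fun n s hs => norm_zetaRemainder_le_of_mem_ball n hs)).differentiableAt
    (Metric.isOpen_ball.mem_nhds hmem)
  rw [(riemannZeta₁_eqOn.eventuallyEq_of_mem
      (Metric.isOpen_ball.mem_nhds hmem)).deriv_eq,
    deriv_fun_add (hasDerivAt_eulerMaclaurinTail one_pos _).differentiableAt hdiff,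
    deriv_eulerMaclaurinTail_neg_one one_pos]
  have h1 := hS.tendsto_sum_nat
  have h2 : Tendsto (fun N : ℕ => ((2 * Real.log (glaisherSeq (N + 1)) - 1 / 2 : ℝ) : ℂ)) atTop
      (𝓝 ((2 * l - 1 / 2 : ℝ) : ℂ)) :=
    (Complex.continuous_ofReal.tendsto _).comp
      ((((tendsto_add_atTop_iff_nat 1).2 hl).const_mul 2).sub_const _)
  have h3 : ∀ N : ℕ, ∑ n ∈ Finset.range N, deriv (zetaRemainder n) (-1) =
      ((2 * Real.log (glaisherSeq (N + 1)) - 1 / 2 : ℝ) : ℂ) := fun N => by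
    simp only [deriv_zetaRemainder_neg_one]
    rw [← Complex.ofReal_sum,
      Finset.sum_range_sub (fun n => 2 * Real.log (glaisherSeq (n + 1))) N,
      log_glaisherSeq (n := 0 + 1) (by omega)]
    simp [hyperfactorial]
    norm_num
  simp only [h3] at h1
  rw [tendsto_nhds_unique h1 h2, ← Complex.ofReal_add]
  congr 1
  simp

theorem riemannZeta_neg_one : riemannZeta (-1) = -1 / 12 := by
  have := riemannZeta_neg_nat_eq_bernoulli' 1
  norm_num [bernoulli'_two] at this
  rw [this, neg_div]

theorem hasDerivAt_riemannZeta_neg_one {l : ℝ}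
    (hl : Tendsto (fun n => Real.log (glaisherSeq n)) atTop (𝓝 l)) :
    HasDerivAt riemannZeta ((1 / 12 - l : ℝ) : ℂ) (-1) := by
  have hd := (differentiableAt_riemannZeta (s := -1) (by norm_num)).hasDerivAt
  have h1 := ((hasDerivAt_id (-1 : ℂ)).sub_const 1).mul hd
  have h2 : riemannZeta₁ =ᶠ[𝓝 (-1)] fun s => (s - 1) * riemannZeta s := by
    filter_upwards [isOpen_ne.mem_nhds (by norm_num : (-1 : ℂ) ≠ 1)] with s hs
    rw [riemannZeta_eq_inv_sub_mul hs, mul_inv_cancel_left₀ (sub_ne_zero.2 hs)]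
  have h3 := (h1.congr_of_eventuallyEq h2).deriv
  rw [deriv_riemannZeta₁_neg_one hl, riemannZeta_neg_one] at h3
  have h4 : ((1 / 12 - l : ℝ) : ℂ) = deriv riemannZeta (-1) := by
    push_cast at h3 ⊢
    simp only [id] at h3
    -- The product rule at `-1` reads `ζ(-1) - 2 ζ'(-1) = 2l - 1 / 4`, with `ζ(-1) = -1 / 12`.
    linear_combination (-1 / 2 : ℂ) * h3
  rwa [h4]

end GlaisherKinkelin

theorem mainTheorem1 :
    -- the improper integral defining `Ci` converges
    (∀ z : ℝ, 0 < z →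
      Tendsto (fun R : ℝ => -∫ t in z..R, Real.cos t / t) atTop (𝓝 (GlaisherKinkelin.Ci z))) ∧
    -- the limit defining `A` exists and is positive
    Tendsto GlaisherKinkelin.glaisherSeq atTop (𝓝 GlaisherKinkelin.glaisherA) ∧
    0 < GlaisherKinkelin.glaisherA ∧
    -- the series, indexed by `k + 1` with `k ≥ 0`, converges
    Summable (fun k : ℕ =>
      GlaisherKinkelin.Ci (2 * ((k : ℝ) + 1) * Real.pi) / ((k : ℝ) + 1) ^ 2) ∧
    Real.log GlaisherKinkelin.glaisherA =
      1 / 4 * (1 + 2 / Real.pi ^ 2 *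
        ∑' k : ℕ, GlaisherKinkelin.Ci (2 * ((k : ℝ) + 1) * Real.pi) / ((k : ℝ) + 1) ^ 2) ∧
    HasDerivAt riemannZeta
      ((-(1 / 6) - 1 / (2 * Real.pi ^ 2) *
        ∑' k : ℕ, GlaisherKinkelin.Ci (2 * ((k : ℝ) + 1) * Real.pi) / ((k : ℝ) + 1) ^ 2 : ℝ) : ℂ)
      (-1) := by
  refine ⟨fun z hz => GlaisherKinkelin.tendsto_Ci hz, ?_, ?_, GlaisherKinkelin.summable_Ci, ?_, ?_⟩
  · rw [GlaisherKinkelin.glaisherA_eq]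
    exact GlaisherKinkelin.tendsto_glaisherSeq_exp
  · rw [GlaisherKinkelin.glaisherA_eq]
    exact Real.exp_pos _
  · rw [GlaisherKinkelin.glaisherA_eq, Real.log_exp]
  · convert GlaisherKinkelin.hasDerivAt_riemannZeta_neg_one
      GlaisherKinkelin.tendsto_log_glaisherSeq using 2
    ring
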